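/- Let $D$ be a finite digraph (parallel arcs allowed, loops not), let $k>0$ be an integer, let $I_1,\dots,I_l$ be a partition of $[k]=\{1,\dots,k\}$ into nonempty blocks, let $c'_1,\dots,c'_l$ be nonnegative integers, and let $U_1,\dots,U_k\subseteq V(D)$ satisfy $\sum_{i\in I_\alpha}|U_i|\le c'_\alpha$ for $1\le\alpha\le l$. An $r$-arborescence is a digraph whose underlying undirected graph is a tree and in which, for every vertex $u$, there is exactly one directed path from $r$ to $u$; the vertex $r$ is its root. A branching $B$ in $D$ is a spanning subdigraph of $D$ each (weakly connected) component of which is an arborescence; its root set $R(B)$ is the set of the roots of its components. For $X\subseteq V(D)$, let $d_D^-(X)$ be the number of arcs of $D$ with tail outside $X$ and head in $X$, and for $I\subseteq[k]$ let $P_I(X)=\{i\in I: X\cap U_i=\emptyset\}$. Then there exist $k$ pairwise arc-disjoint branchings $B_1,\dots,B_k$ in $D$ such that $U_i\subseteq R(B_i)$ for $1\le i\le k$ and $\sum_{i\in I_\alpha}|R(B_i)|\le c'_\alpha$ for $1\le\alpha\le l$ if and only if, for every $t\ge 0$, all pairwise disjoint nonempty sets $X_1,\dots,X_t\subseteq V(D)$,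 and every $I\subseteq[k]$ that is the union of some (possibly none) of $I_1,\dots,I_l$, $$\sum_{j=1}^{t}\bigl(|P_I(X_j)|-d_D^-(X_j)\bigr)\le\sum_{\alpha:\,I_\alpha\subseteq I}\Bigl(c'_\alpha-\sum_{i\in I_\alpha}|U_i|\Bigr).$$ -/

import Mathlib

/-- A digraph with vertex type `V` and arc type `A`: parallel arcs are allowed, loops are not. -/
structure MultiDigraph (V A : Type*) where
  tail : A → V
  head : A → V
  loopless : ∀ a, tail a ≠ head a

namespace MultiDigraph

variable {V A : Type*}

/-- The in-degree `d⁻(X)`: the number of arcs with tail outside `X` and head in `X`. -/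
def inDegree [Fintype A] [DecidableEq V] (D : MultiDigraph V A) (X : Finset V) : ℕ :=
  (Finset.univ.filter fun a => D.tail a ∉ X ∧ D.head a ∈ X).card

/-- A subdigraph (not necessarily spanning). -/
structure Subdigraph (D : MultiDigraph V A) where
  verts : Set V
  arcs : Set A
  tail_mem : ∀ a ∈ arcs, D.tail a ∈ verts
  head_mem : ∀ a ∈ arcs, D.head a ∈ verts

namespace Subdigraph

variable {D : MultiDigraph V A}

/-- The adjacency relation of the underlying undirected graph of a subdigraph. -/
def underlying (F : D.Subdigraph) : SimpleGraph F.verts where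
  Adj u v := ∃ a ∈ F.arcs,
    (D.tail a = u ∧ D.head a = v) ∨ (D.tail a = v ∧ D.head a = u)
  symm := ⟨fun _ _ ⟨a, ha, h⟩ => ⟨a, ha, h.symm⟩⟩
  loopless := ⟨fun _ ⟨a, _, h⟩ =>
    h.elim (fun h => D.loopless a (h.1.trans h.2.symm))
      (fun h => D.loopless a (h.1.trans h.2.symm))⟩

/-- The underlying undirected multigraph is a tree: no two arcs join the same unordered pair of
vertices, and the graph of adjacencies is a tree. -/
def IsUnderlyingTree (F : D.Subdigraph) : Prop :=
  F.underlying.IsTree ∧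
    ∀ a ∈ F.arcs, ∀ b ∈ F.arcs, s(D.tail a, D.head a) = s(D.tail b, D.head b) → a = b

/-- `F.IsDirWalk u p v`: the list of arcs `p` is a directed walk of `F` from `u` to `v`. -/
def IsDirWalk (F : D.Subdigraph) : V → List A → V → Prop
  | u, [], v => u ∈ F.verts ∧ u = v
  | u, a :: p, v => a ∈ F.arcs ∧ D.tail a = u ∧ F.IsDirWalk (D.head a) p v

/-- A directed path: a directed walk that repeats no vertex. -/
def IsDirPath (F : D.Subdigraph) (u : V) (p : List A) (v : V) : Prop :=
  F.IsDirWalk u p v ∧ (u :: p.map D.head).Nodup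

/-- `F` is an `r`-arborescence: its underlying graph is a tree and, for each vertex `u` of `F`,
there is exactly one directed path in `F` from `r` to `u`. -/
def IsArborescence (F : D.Subdigraph) (r : V) : Prop :=
  r ∈ F.verts ∧ F.IsUnderlyingTree ∧ ∀ u ∈ F.verts, ∃! p : List A, F.IsDirPath r p u

/-- The subdigraph of `F` induced on `S`. -/
def induce (F : D.Subdigraph) (S : Set V) : D.Subdigraph where
  verts := {v | v ∈ F.verts ∧ v ∈ S}
  arcs := {a | a ∈ F.arcs ∧ D.tail a ∈ S ∧ D.head a ∈ S}
  tail_mem a h := ⟨F.tail_mem a h.1, h.2.1⟩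
  head_mem a h := ⟨F.head_mem a h.1, h.2.2⟩

/-- The (weakly connected) component of `F` given by a connected component of its underlying
undirected graph. -/
def component (F : D.Subdigraph) (C : F.underlying.ConnectedComponent) : D.Subdigraph :=
  F.induce (Subtype.val '' C.supp)

/-- A branching of `D`: a spanning subdigraph each component of which is an arborescence. -/
def IsBranching (B : D.Subdigraph) : Prop :=
  B.verts = Set.univ ∧ ∀ C, ∃ r, (B.component C).IsArborescence r

/-- The set of the roots of the components. -/
def rootSet (B : D.Subdigraph) : Set V :=
  {r | ∃ C, (B.component C).IsArborescence r}

end Subdigraph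

end MultiDigraph

/-- `P_I(X)`: the set of all `i ∈ I` with `X ∩ U i = ∅`. -/
def missedBy {V : Type*} [DecidableEq V] {k : ℕ} (U : Fin k → Finset V) (I : Finset (Fin k))
    (X : Finset V) : Finset (Fin k) :=
  I.filter fun i => X ∩ U i = ∅

/-- The family `I₁, …, I_l` is a partition of `[k]` into nonempty blocks. -/
def IsBlockPartition {k l : ℕ} (I : Fin l → Finset (Fin k)) : Prop :=
  (∀ α, (I α).Nonempty) ∧ (∀ α β, α ≠ β → Disjoint (I α) (I β)) ∧
    Finset.univ.biUnion I = Finset.univ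

/-!
By Edmonds' disjoint branchings theorem, arc-disjoint branchings with the root sets `R i` exist if
and only if at most `d⁻(X)` of the sets `R i` miss each nonempty set `X` of vertices. The task is
therefore to enlarge the sets `U i` to sets `R i` with this property within the bounds `c'`.

The condition on the families `X₁, …, X_t` is necessary because every `i` that misses `X_j` for `U`
but not for `R` has used a new root in `X_j`. Conversely, take sets `R i` maximal subject to this
condition. If every colour class `I α` with room left has no vertex left to add, the condition for a
single set `X` and for the union of the exhausted classes is the cut condition. Otherwise fix a
class `α` with room left: each pair `(i, v)` with `i ∈ I α` and `v ∉ R i` is blocked by a tight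
family of disjoint sets, seen as rectangles in `V × [k]` that avoid the point `(v, i)`. Adding up
all these families gives a weighted cover in which each point of colour `α` is covered at least once
less than `α` is paid for. Since the demand is supermodular, uncrossing turns the family into a
laminar one, whose layers of minimal members are again disjoint families, so the condition bounds
its total demand by a quantity smaller than the sum of the tight values, a contradiction.
-/

section Lattice

variable {α : Type*} [Lattice α] [OrderTop α] {ρ : α → ℕ}

theorem mul_top_sub_add_lt (hρ : StrictMono ρ)
    (hmod : ∀ a b, ρ (a ⊓ b) + ρ (a ⊔ b) = ρ a + ρ b) {a b : α} (hab : ¬ a ≤ b) (hba : ¬ b ≤ a) :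
    ρ (a ⊓ b) * (ρ ⊤ - ρ (a ⊓ b)) + ρ (a ⊔ b) * (ρ ⊤ - ρ (a ⊔ b)) <
      ρ a * (ρ ⊤ - ρ a) + ρ b * (ρ ⊤ - ρ b) := by
  obtain ⟨s, hs⟩ := Nat.exists_eq_add_of_lt (hρ (inf_lt_left.2 hab))
  obtain ⟨t, ht⟩ := Nat.exists_eq_add_of_lt (hρ (inf_lt_right.2 hba))
  obtain ⟨u, hu⟩ := Nat.exists_eq_add_of_le (hρ.monotone (le_top (a := a ⊔ b)))
  have hsup : ρ (a ⊔ b) = ρ (a ⊓ b) + s + t + 2 := by linarith [hmod a b]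
  have h₁ : ρ ⊤ - ρ (a ⊓ b) = s + t + 2 + u := by omega
  have h₂ : ρ ⊤ - ρ (a ⊔ b) = u := by omega
  have h₃ : ρ ⊤ - ρ a = t + 1 + u := by omega
  have h₄ : ρ ⊤ - ρ b = s + 1 + u := by omega
  rw [h₁, h₂, h₃, h₄, hs, ht, hsup]
  nlinarith

theorem exists_forall_le_or_le_of_uncross (hρ : StrictMono ρ)
    (hmod : ∀ a b, ρ (a ⊓ b) + ρ (a ⊔ b) = ρ a + ρ b) {r : α → α → Prop} {P : Multiset α → Prop}
    (hP : ∀ a b F, r a b → P (a ::ₘ b ::ₘ F) → P ((a ⊓ b) ::ₘ (a ⊔ b) ::ₘ F))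
    {F : Multiset α} (hF : P F) :
    ∃ F', P F' ∧ ∀ a ∈ F', ∀ b ∈ F', r a b → a ≤ b ∨ b ≤ a := by
  let potential (F : Multiset α) : ℕ := (F.map fun a => ρ a * (ρ ⊤ - ρ a)).sum
  obtain ⟨F', hF', hmin⟩ := (measure potential).wf.has_min {F | P F} ⟨F, hF⟩
  refine ⟨F', hF', fun a ha b hb hr => ?_⟩
  by_contra! ⟨hab, hba⟩
  obtain ⟨F₁, rfl⟩ := Multiset.exists_cons_of_mem ha
  obtain ⟨F₂, rfl⟩ := Multiset.exists_cons_of_mem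
    ((Multiset.mem_cons.1 hb).resolve_left fun h => hab h.ge)
  refine hmin _ (hP a b F₂ hr hF') ?_
  have hlt := mul_top_sub_add_lt hρ hmod hab hba
  change potential _ < potential _
  simp only [potential, Multiset.map_cons, Multiset.sum_cons]
  omega

end Lattice

section Rect

open OrderDual (toDual ofDual)

/-- The rectangle `X × J` in `V × K`, encoded as the pair `(X, J)`. The order on `J` is reversed,
so that `⊓` and `⊔` of `(X, I)` and `(Y, J)` are `(X ∩ Y, I ∪ J)` and `(X ∪ Y, I ∩ J)`. -/
abbrev Rect (V K : Type*) := Finset V × (Finset K)ᵒᵈ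

variable {V K L : Type*}

namespace Rect

/-- A family of rectangles is laminar if any two of its members whose vertex sets meet are
comparable. -/
def IsLaminar (F : Multiset (Rect V K)) : Prop :=
  ∀ G ∈ F, ∀ H ∈ F, ¬ Disjoint G.1 H.1 → G ≤ H ∨ H ≤ G

theorem IsLaminar.mono {F F' : Multiset (Rect V K)} (hF : IsLaminar F) (h : F' ≤ F) :
    IsLaminar F' := fun G hG H hH => hF G (Multiset.mem_of_le h hG) H (Multiset.mem_of_le h hH)

/-- On families of rectangles with disjoint vertex sets whose indices have colours in `S`, the
function `p` sums to at most `∑ c ∈ S, b c`. -/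
def BoundedOnDisjoint (p : Rect V K → ℤ) (col : K → L) (b : L → ℤ) : Prop :=
  ∀ M : Finset (Rect V K), (∀ G ∈ M, G.1.Nonempty) →
    (M : Set (Rect V K)).PairwiseDisjoint Prod.fst →
      ∀ S : Finset L, (∀ G ∈ M, ∀ i ∈ ofDual G.2, col i ∈ S) → ∑ G ∈ M, p G ≤ ∑ c ∈ S, b c

variable {p : Rect V K → ℤ} {col : K → L} {b : L → ℤ}

theorem BoundedOnDisjoint.nonneg (hp : BoundedOnDisjoint p col b) (c : L) : 0 ≤ b c := by
  simpa using hp ∅ (by simp) (by simp) {c} (by simp)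

variable [DecidableEq K]

/-- The rank of a rectangle in the modular lattice `Rect V K`. -/
def rank [Fintype K] (G : Rect V K) : ℕ := G.1.card + (ofDual G.2)ᶜ.card

theorem rank_strictMono [Fintype K] : StrictMono (rank : Rect V K → ℕ) := by
  intro G H hGH
  rcases Prod.lt_iff.1 hGH with ⟨h₁, h₂⟩ | ⟨h₁, h₂⟩
  · exact add_lt_add_of_lt_of_le (Finset.card_lt_card h₁)
      (Finset.card_le_card (Finset.compl_subset_compl.2 h₂))
  · exact add_lt_add_of_le_of_lt (Finset.card_le_card h₁)
      (Finset.card_lt_card (compl_lt_compl_iff_lt.2 h₂))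

variable [DecidableEq V]

theorem rank_inf_add_rank_sup [Fintype K] (G H : Rect V K) :
    rank (G ⊓ H) + rank (G ⊔ H) = rank G + rank H := by
  have h₁ := Finset.card_inter_add_card_union G.1 H.1
  have h₂ := Finset.card_inter_add_card_union (ofDual G.2)ᶜ (ofDual H.2)ᶜ
  rw [← Finset.compl_union, ← Finset.compl_inter] at h₂
  simp only [rank, Prod.fst_inf, Prod.snd_inf, Prod.fst_sup, Prod.snd_sup, ofDual_inf, ofDual_sup,
    Finset.inf_eq_inter, Finset.sup_eq_union]
  omega

/-- The number of rectangles of the family `F` that contain the point `(v, i)`. -/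
def coverCount (F : Multiset (Rect V K)) (v : V) (i : K) : ℕ :=
  F.countP fun G => v ∈ G.1 ∧ i ∈ ofDual G.2

theorem coverCount_pos {F : Multiset (Rect V K)} {v : V} {i : K} :
    0 < coverCount F v i ↔ ∃ G ∈ F, v ∈ G.1 ∧ i ∈ ofDual G.2 :=
  Multiset.countP_pos

theorem coverCount_uncross_le (G H : Rect V K) (F : Multiset (Rect V K)) (v : V) (i : K) :
    coverCount ((G ⊓ H) ::ₘ (G ⊔ H) ::ₘ F) v i ≤ coverCount (G ::ₘ H ::ₘ F) v i := by
  simp only [coverCount, Multiset.countP_cons, Prod.fst_inf, Prod.snd_inf, Prod.fst_sup,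
    Prod.snd_sup, ofDual_inf, ofDual_sup, Finset.inf_eq_inter, Finset.sup_eq_union,
    Finset.mem_inter, Finset.mem_union]
  split_ifs <;> first | omega | (exfalso; tauto)

theorem coverCount_sum {ι : Type*} (s : Finset ι) (F : ι → Multiset (Rect V K)) (v : V) (i : K) :
    coverCount (∑ e ∈ s, F e) v i = ∑ e ∈ s, coverCount (F e) v i :=
  map_sum (Multiset.countPAddMonoidHom fun G : Rect V K => v ∈ G.1 ∧ i ∈ ofDual G.2) _ _

open scoped Classical in
/-- The minimal members of a family of rectangles, each taken once. -/
noncomputable def minimals (F : Multiset (Rect V K)) : Finset (Rect V K) :=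
  F.toFinset.filter (Minimal (· ∈ F))

theorem mem_minimals {F : Multiset (Rect V K)} {G : Rect V K} :
    G ∈ minimals F ↔ Minimal (· ∈ F) G := by
  simpa only [minimals, Finset.mem_filter, Multiset.mem_toFinset] using
    and_iff_right_of_imp Minimal.prop

theorem minimals_val_le (F : Multiset (Rect V K)) : (minimals F).val ≤ F :=
  (Multiset.le_iff_subset (minimals F).nodup).2 fun _ hG => (mem_minimals.1 hG).prop

theorem exists_mem_minimals_le {F : Multiset (Rect V K)} {G : Rect V K} (hG : G ∈ F) :
    ∃ H ∈ minimals F, H ≤ G := by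
  obtain ⟨H, hHG, hH⟩ := F.toFinset.exists_le_minimal (Multiset.mem_toFinset.2 hG)
  exact ⟨H, mem_minimals.2 (by simpa only [Multiset.mem_toFinset] using hH), hHG⟩

theorem IsLaminar.pairwiseDisjoint_minimals {F : Multiset (Rect V K)} (hF : IsLaminar F) :
    (minimals F : Set (Rect V K)).PairwiseDisjoint Prod.fst := by
  intro G hG H hH hne
  rw [Finset.mem_coe, mem_minimals] at hG hH
  change Disjoint G.1 H.1
  by_contra hmeet
  rcases hF G hG.prop H hH.prop hmeet with h | h
  · exact hne (hH.eq_of_le hG.prop h)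
  · exact hne (hG.eq_of_le hH.prop h).symm

/-- The members of a laminar family that contain a point form a chain; a vertex below the bottom of
the chain is in all of them, and in one more rectangle if the bottom is not minimal. -/
theorem IsLaminar.exists_coverCount_lt {F : Multiset (Rect V K)} (hF : IsLaminar F)
    (hne : ∀ G ∈ F, G.1.Nonempty) {v : V} {i : K}
    (hpos : 0 < coverCount (F - (minimals F).val) v i) :
    ∃ u, coverCount (F - (minimals F).val) v i < coverCount F u i := by
  set F' := F - (minimals F).val with hF'
  have hsub : ∀ G ∈ F', G ∈ F := fun G hG => Multiset.mem_of_le tsub_le_self hG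
  obtain ⟨G₀, hG₀, hG₀v⟩ := coverCount_pos.1 hpos
  obtain ⟨G, -, hG⟩ := (F'.toFinset.filter
    fun G => v ∈ G.1 ∧ i ∈ ofDual G.2).exists_le_minimal (a := G₀) (by simp [hG₀, hG₀v])
  simp only [Finset.mem_filter, Multiset.mem_toFinset] at hG
  obtain ⟨hGF', hvG, hiG⟩ := hG.prop
  have hchain : ∀ H ∈ F', v ∈ H.1 ∧ i ∈ ofDual H.2 → G ≤ H := by
    intro H hH hvH
    rcases hF G (hsub G hGF') H (hsub H hH) (Finset.not_disjoint_iff.2 ⟨v, hvG, hvH.1⟩) with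
      h | h
    · exact h
    · exact (hG.eq_of_le ⟨hH, hvH⟩ h).ge
  obtain ⟨B, hB, hBG⟩ := exists_mem_minimals_le (hsub G hGF')
  obtain ⟨u, hu⟩ := hne B (mem_minimals.1 hB).prop
  refine ⟨u, ?_⟩
  have hle : coverCount F' v i ≤ coverCount F' u i := by
    simp only [coverCount, Multiset.countP_eq_card_filter]
    refine Multiset.card_le_card (Multiset.le_filter.2 ⟨Multiset.filter_le _ _, fun H hH => ?_⟩)
    obtain ⟨hHF', hvH⟩ := Multiset.mem_filter.1 hH
    exact ⟨(hBG.trans (hchain H hHF' hvH)).1 hu, hvH.2⟩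
  have hone : 0 < coverCount (minimals F).val u i := coverCount_pos.2 ⟨B, hB, hu, hBG.2 hiG⟩
  have hadd : coverCount F u i = coverCount F' u i + coverCount (minimals F).val u i := by
    rw [coverCount, coverCount, coverCount, ← Multiset.countP_add, hF',
      tsub_add_cancel_of_le (minimals_val_le F)]
  omega

theorem BoundedOnDisjoint.sum_le_of_isLaminar [Fintype L] (hp : BoundedOnDisjoint p col b)
    {F : Multiset (Rect V K)} (hF : IsLaminar F) (hne : ∀ G ∈ F, G.1.Nonempty) {z : L → ℕ}
    (hz : ∀ v i, coverCount F v i ≤ z (col i)) :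
    (F.map p).sum ≤ ∑ c, (z c : ℤ) * b c := by
  classical
  induction hn : F.card using Nat.strong_induction_on generalizing F z with
  | _ n ih =>
  obtain rfl | ⟨G₀, hG₀⟩ := F.empty_or_exists_mem
  · simpa using Finset.sum_nonneg fun c _ => mul_nonneg (Nat.cast_nonneg (z c)) (hp.nonneg c)
  have hMF : ∀ G ∈ minimals F, G ∈ F := fun G hG => (mem_minimals.1 hG).prop
  have hsub : F - (minimals F).val ≤ F := tsub_le_self
  let S : Finset L := (minimals F).biUnion fun G => (ofDual G.2).image col
  have hS : ∀ G ∈ minimals F, ∀ i ∈ ofDual G.2, col i ∈ S := fun G hG i hi =>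
    Finset.mem_biUnion.2 ⟨G, hG, Finset.mem_image_of_mem col hi⟩
  have hzS : ∀ c ∈ S, 1 ≤ z c := by
    intro c hc
    obtain ⟨G, hG, hc⟩ := Finset.mem_biUnion.1 hc
    obtain ⟨i, hi, rfl⟩ := Finset.mem_image.1 hc
    obtain ⟨v, hv⟩ := hne G (hMF G hG)
    exact (coverCount_pos.2 ⟨G, hMF G hG, hv, hi⟩).trans_le (hz v i)
  have hz' : ∀ v i, coverCount (F - (minimals F).val) v i ≤
      z (col i) - if col i ∈ S then 1 else 0 := by
    intro v i
    rcases Nat.eq_zero_or_pos (coverCount (F - (minimals F).val) v i) with h | h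
    · omega
    · obtain ⟨u, hu⟩ := hF.exists_coverCount_lt hne h
      have := hz u i
      split_ifs <;> omega
  have hcard : (F - (minimals F).val).card < n := by
    obtain ⟨H, hH, -⟩ := exists_mem_minimals_le hG₀
    rw [Multiset.card_sub (minimals_val_le F), ← hn]
    exact Nat.sub_lt (Multiset.card_pos_iff_exists_mem.2 ⟨G₀, hG₀⟩)
      (Multiset.card_pos_iff_exists_mem.2 ⟨H, hH⟩)
  calc (F.map p).sum = ((F - (minimals F).val).map p).sum + ∑ G ∈ minimals F, p G := by
        rw [Finset.sum, ← Multiset.sum_add, ← Multiset.map_add,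
          tsub_add_cancel_of_le (minimals_val_le F)]
    _ ≤ ∑ c, ((z c - if c ∈ S then 1 else 0 : ℕ) : ℤ) * b c + ∑ c ∈ S, b c := add_le_add
        (ih _ hcard (hF.mono hsub) (fun G hG => hne G (Multiset.mem_of_le hsub hG)) hz' rfl)
        (hp _ (fun G hG => hne G (hMF G hG)) hF.pairwiseDisjoint_minimals S hS)
    _ = ∑ c, (z c : ℤ) * b c := by
        rw [show ∑ c ∈ S, b c = ∑ c, if c ∈ S then b c else 0 by simp, ← Finset.sum_add_distrib]
        refine Finset.sum_congr rfl fun c _ => ?_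
        split_ifs with h
        · push_cast [hzS c h]
          ring
        · simp

theorem exists_isLaminar_of_supermodular [Finite V] [Finite K]
    (hp : ∀ G H : Rect V K, (G.1 ∩ H.1).Nonempty → p G + p H ≤ p (G ⊓ H) + p (G ⊔ H))
    {F : Multiset (Rect V K)} (hne : ∀ G ∈ F, G.1.Nonempty) :
    ∃ F', IsLaminar F' ∧ (∀ G ∈ F', G.1.Nonempty) ∧ (F.map p).sum ≤ (F'.map p).sum ∧
      ∀ v i, coverCount F' v i ≤ coverCount F v i := by
  cases nonempty_fintype V
  cases nonempty_fintype K
  let P (F' : Multiset (Rect V K)) : Prop := (∀ G ∈ F', G.1.Nonempty) ∧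
    (F.map p).sum ≤ (F'.map p).sum ∧ ∀ v i, coverCount F' v i ≤ coverCount F v i
  have hP : ∀ G H F', ¬ Disjoint G.1 H.1 → P (G ::ₘ H ::ₘ F') →
      P ((G ⊓ H) ::ₘ (G ⊔ H) ::ₘ F') := by
    rintro G H F' hGH ⟨hne', hsum, hcover⟩
    rw [Finset.not_disjoint_iff_nonempty_inter] at hGH
    refine ⟨?_, ?_, fun v i => (coverCount_uncross_le G H F' v i).trans (hcover v i)⟩
    · simp only [Multiset.forall_mem_cons] at hne' ⊢
      exact ⟨hGH, hne'.1.mono Finset.subset_union_left, hne'.2.2⟩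
    · simp only [Multiset.map_cons, Multiset.sum_cons] at hsum ⊢
      linarith [hp G H hGH]
  obtain ⟨F', ⟨hne', hsum, hcover⟩, hlam⟩ := exists_forall_le_or_le_of_uncross rank_strictMono
    rank_inf_add_rank_sup hP (F := F) ⟨hne, le_rfl, fun _ _ => le_rfl⟩
  exact ⟨F', hlam, hne', hsum, hcover⟩

theorem BoundedOnDisjoint.sum_le_of_coverCount_le [Finite V] [Finite K] [Fintype L]
    (hb : BoundedOnDisjoint p col b)
    (hp : ∀ G H : Rect V K, (G.1 ∩ H.1).Nonempty → p G + p H ≤ p (G ⊓ H) + p (G ⊔ H))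
    {F : Multiset (Rect V K)} (hne : ∀ G ∈ F, G.1.Nonempty) {z : L → ℕ}
    (hz : ∀ v i, coverCount F v i ≤ z (col i)) :
    (F.map p).sum ≤ ∑ c, (z c : ℤ) * b c := by
  obtain ⟨F', hlam, hne', hsum, hcover⟩ := exists_isLaminar_of_supermodular hp hne
  exact hsum.trans (hb.sum_le_of_isLaminar hlam hne' fun v i => (hcover v i).trans (hz v i))

end Rect

end Rect

section RootSets

open OrderDual (toDual ofDual)

section InsertAt

variable {ι α : Type*} [DecidableEq ι] [DecidableEq α] {R : ι → Finset α} {i j : ι} {a b : α}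

/-- The family obtained from `R` by adding the element `a` to its `i`-th member. -/
def insertAt (R : ι → Finset α) (i : ι) (a : α) : ι → Finset α :=
  Function.update R i (insert a (R i))

theorem insertAt_self : insertAt R i a i = insert a (R i) := Function.update_self ..

theorem insertAt_of_ne (h : j ≠ i) : insertAt R i a j = R j := Function.update_of_ne h ..

theorem mem_insertAt : b ∈ insertAt R i a j ↔ (j = i ∧ b = a) ∨ b ∈ R j := by
  rcases eq_or_ne j i with rfl | h
  · simp [insertAt_self]
  · simp [insertAt_of_ne h, h]

theorem mem_insertAt_self : a ∈ insertAt R i a i := mem_insertAt.2 (Or.inl ⟨rfl, rfl⟩)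

theorem le_insertAt : R ≤ insertAt R i a := fun _ _ hb => mem_insertAt.2 (Or.inr hb)

theorem lt_insertAt (ha : a ∉ R i) : R < insertAt R i a :=
  lt_of_le_not_ge le_insertAt fun h => ha (h i mem_insertAt_self)

theorem card_insertAt (ha : a ∉ R i) (j : ι) :
    (insertAt R i a j).card = (R j).card + if j = i then 1 else 0 := by
  rcases eq_or_ne j i with rfl | h
  · simp [insertAt_self, ha]
  · simp [insertAt_of_ne h, h]

end InsertAt

variable {V L : Type*} {k : ℕ}

section MissedBy

variable [DecidableEq V]

theorem mem_missedBy {U : Fin k → Finset V} {I : Finset (Fin k)} {X : Finset V} {i : Fin k} :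
    i ∈ missedBy U I X ↔ i ∈ I ∧ ∀ v ∈ X, v ∉ U i := by
  simp [missedBy, Finset.eq_empty_iff_forall_notMem]

theorem missedBy_anti {U R : Fin k → Finset V} (h : U ≤ R) (J : Finset (Fin k)) (X : Finset V) :
    missedBy R J X ⊆ missedBy U J X := fun i hi => by
  rw [mem_missedBy] at hi ⊢
  exact ⟨hi.1, fun v hv hvU => hi.2 v hv (h i hvU)⟩

theorem missedBy_union_subset (U : Fin k → Finset V) (I J : Finset (Fin k)) (X Y : Finset V) :
    missedBy U I X ∪ missedBy U J Y ⊆ missedBy U (I ∪ J) (X ∩ Y) := fun i => by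
  simp only [Finset.mem_union, Finset.mem_inter, mem_missedBy]
  grind

theorem missedBy_inter_subset (U : Fin k → Finset V) (I J : Finset (Fin k)) (X Y : Finset V) :
    missedBy U I X ∩ missedBy U J Y ⊆ missedBy U (I ∩ J) (X ∪ Y) := fun i => by
  simp only [Finset.mem_union, Finset.mem_inter, mem_missedBy]
  grind

end MissedBy

/-- The set of all indices whose colour is in `S`. -/
def coloredIn [DecidableEq L] (col : Fin k → L) (S : Finset L) : Finset (Fin k) := {i | col i ∈ S}

theorem mem_coloredIn [DecidableEq L] {col : Fin k → L} {S : Finset L} {i : Fin k} :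
    i ∈ coloredIn col S ↔ col i ∈ S := by
  simp [coloredIn]

/-- The number of roots that the families of colour `α` can still receive when `c α` is the total
number allowed. -/
def slack [DecidableEq L] (c : L → ℤ) (col : Fin k → L) (R : Fin k → Finset V) (α : L) : ℤ :=
  c α - ∑ i with col i = α, ((R i).card : ℤ)

theorem sum_slack_add_sum_card [DecidableEq L] (c : L → ℤ) (col : Fin k → L) (R : Fin k → Finset V)
    (S : Finset L) :
    ∑ α ∈ S, slack c col R α + ∑ i ∈ coloredIn col S, ((R i).card : ℤ) = ∑ α ∈ S, c α := by
  have h : ∑ i ∈ coloredIn col S, ∑ _α ∈ {col i}, ((R i).card : ℤ) =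
      ∑ α ∈ S, ∑ i with col i = α, ((R i).card : ℤ) := Finset.sum_comm' fun i α => by
    simp only [mem_coloredIn, Finset.mem_singleton, Finset.mem_filter, Finset.mem_univ, true_and]
    grind
  simp only [Finset.sum_singleton] at h
  simp only [slack, Finset.sum_sub_distrib, h, sub_add_cancel]

/-- The excess of the number of families in `J` without root in `X` over the number `d X` of arcs
available to them, for the rectangle `X × J`. -/
def demand [DecidableEq V] (d : Finset V → ℤ) (R : Fin k → Finset V) (G : Rect V (Fin k)) : ℤ :=
  (missedBy R (ofDual G.2) G.1).card - d G.1

variable [DecidableEq V] [DecidableEq L]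

/-- The condition under which the root sets `R i` can be enlarged, with at most `c α` roots in
total for the colour `α`, so that the families without root in `X` number at most `d X`. -/
def PackingCondition (d : Finset V → ℤ) (c : L → ℤ) (col : Fin k → L) (R : Fin k → Finset V) :
    Prop :=
  ∀ M : Finset (Finset V), (∀ X ∈ M, X.Nonempty) → (M : Set (Finset V)).PairwiseDisjoint id →
    ∀ S : Finset L, ∑ X ∈ M, demand d R (X, toDual (coloredIn col S)) ≤
      ∑ α ∈ S, slack c col R α

variable {d : Finset V → ℤ} {c : L → ℤ} {col : Fin k → L} {U R : Fin k → Finset V}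
  {X : Finset V}

theorem slack_insertAt {i : Fin k} {v : V} (hv : v ∉ R i) (α : L) :
    slack c col (insertAt R i v) α = slack c col R α - if col i = α then 1 else 0 := by
  simp only [slack, card_insertAt hv, Nat.cast_add, Finset.sum_add_distrib, Nat.cast_ite,
    Nat.cast_one, Nat.cast_zero, Finset.sum_ite_eq', Finset.mem_filter, Finset.mem_univ, true_and]
  ring

theorem demand_anti (h : U ≤ R) (G : Rect V (Fin k)) : demand d R G ≤ demand d U G :=
  sub_le_sub_right (Nat.cast_le.2 (Finset.card_le_card (missedBy_anti h _ _))) _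

theorem demand_mono_indices {I J : Finset (Fin k)} (h : I ⊆ J) :
    demand d R (X, toDual I) ≤ demand d R (X, toDual J) :=
  sub_le_sub_right (Nat.cast_le.2 (Finset.card_le_card (Finset.filter_subset_filter _ h))) _

theorem demand_missedBy (h : U ≤ R) (J : Finset (Fin k)) (X : Finset V) :
    demand d U (X, toDual (missedBy R J X)) = demand d R (X, toDual J) := by
  have : missedBy U (missedBy R J X) X = missedBy R J X :=
    Finset.filter_eq_self.2 fun i hi => (Finset.mem_filter.1 (missedBy_anti h J X hi)).2
  simp only [demand, OrderDual.ofDual_toDual, this]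

theorem demand_add_le (hd : ∀ X Y, (X ∩ Y).Nonempty → d (X ∩ Y) + d (X ∪ Y) ≤ d X + d Y)
    (R : Fin k → Finset V) (G H : Rect V (Fin k)) (hGH : (G.1 ∩ H.1).Nonempty) :
    demand d R G + demand d R H ≤ demand d R (G ⊓ H) + demand d R (G ⊔ H) := by
  have hunion := Finset.card_le_card (missedBy_union_subset R (ofDual G.2) (ofDual H.2) G.1 H.1)
  have hinter := Finset.card_le_card (missedBy_inter_subset R (ofDual G.2) (ofDual H.2) G.1 H.1)
  have := Finset.card_union_add_card_inter (missedBy R (ofDual G.2) G.1)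
    (missedBy R (ofDual H.2) H.1)
  have := hd G.1 H.1 hGH
  simp only [demand, Prod.fst_inf, Prod.snd_inf, Prod.fst_sup, Prod.snd_sup, ofDual_inf, ofDual_sup,
    Finset.inf_eq_inter, Finset.sup_eq_union]
  omega

theorem PackingCondition.slack_nonneg (hR : PackingCondition d c col R) (α : L) :
    0 ≤ slack c col R α := by
  simpa using hR ∅ (by simp) (by simp) {α}

theorem PackingCondition.boundedOnDisjoint (hR : PackingCondition d c col R) :
    Rect.BoundedOnDisjoint (demand d R) col (slack c col R) := by
  intro M hne hdis S hS
  have hinj : Set.InjOn Prod.fst (M : Set (Rect V (Fin k))) := by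
    intro G hG H hH h
    by_contra hGH
    exact (hne G hG).ne_empty (Finset.disjoint_self_iff_empty _ |>.1 (by
      simpa only [Function.onFun, ← h] using hdis hG hH hGH))
  calc ∑ G ∈ M, demand d R G
      ≤ ∑ G ∈ M, demand d R (G.1, toDual (coloredIn col S)) :=
        Finset.sum_le_sum fun G hG => demand_mono_indices fun i hi => mem_coloredIn.2 (hS G hG i hi)
    _ = ∑ X ∈ M.image Prod.fst, demand d R (X, toDual (coloredIn col S)) :=
        (Finset.sum_image (f := fun X => demand d R (X, toDual (coloredIn col S))) hinj).symm
    _ ≤ ∑ α ∈ S, slack c col R α := hR _ (by simpa using hne)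
        (by simpa using (Set.InjOn.pairwiseDisjoint_image (f := id) hinj).2 hdis) S

/-- The rectangles `F` and the colours `S` witness that `v` cannot be added to `R i`: they are tight
for `R`, and the rectangles are disjoint and avoid the point `(v, i)`. -/
structure IsBlocker (d : Finset V → ℤ) (c : L → ℤ) (col : Fin k → L) (R : Fin k → Finset V)
    (i : Fin k) (v : V) (F : Multiset (Rect V (Fin k))) (S : Finset L) : Prop where
  col_mem : col i ∈ S
  nonempty : ∀ G ∈ F, G.1.Nonempty
  sum_slack_le : ∑ α ∈ S, slack c col R α ≤ (F.map (demand d R)).sum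
  coverCount_le : ∀ w j, Rect.coverCount F w j ≤
    if col j ∈ S ∧ w ∉ insertAt R i v j then 1 else 0

theorem PackingCondition.exists_isBlocker (hR : PackingCondition d c col R) {i : Fin k} {v : V}
    (hv : v ∉ R i) (hQ : ¬ PackingCondition d c col (insertAt R i v)) :
    ∃ F S, IsBlocker d c col R i v F S := by
  simp only [PackingCondition] at hQ
  push Not at hQ
  obtain ⟨M, hne, hdis, S, hlt⟩ := hQ
  simp only [slack_insertAt hv, Finset.sum_sub_distrib, Finset.sum_ite_eq] at hlt
  have hle : ∑ X ∈ M, demand d (insertAt R i v) (X, toDual (coloredIn col S)) ≤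
      ∑ X ∈ M, demand d R (X, toDual (coloredIn col S)) :=
    Finset.sum_le_sum fun X _ => demand_anti le_insertAt _
  have htight := hR M hne hdis S
  let J := fun X => missedBy (insertAt R i v) (coloredIn col S) X
  refine ⟨M.val.map fun X => (X, toDual (J X)), S, by_contra fun hi => ?_, ?_, ?_, fun w j => ?_⟩
  · rw [if_neg hi] at hlt
    omega
  · simpa using hne
  · rw [Multiset.map_map]
    simp only [Function.comp_def, J, demand_missedBy le_insertAt]
    change _ ≤ ∑ X ∈ M, demand d (insertAt R i v) (X, toDual (coloredIn col S))
    split_ifs at hlt <;> omega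
  · rw [Rect.coverCount, Multiset.countP_map]
    change (M.filter fun X => w ∈ X ∧ j ∈ J X).card ≤ _
    split_ifs with h
    · refine Finset.card_le_one.2 fun X hX Y hY => by_contra fun hXY => ?_
      rw [Finset.mem_filter] at hX hY
      exact Finset.disjoint_left.1 (hdis hX.1 hY.1 hXY) hX.2.1 hY.2.1
    · rw [Nat.le_zero, Finset.card_eq_zero, Finset.filter_eq_empty_iff]
      rintro X - ⟨hw, hj⟩
      rw [mem_missedBy, mem_coloredIn] at hj
      exact h ⟨hj.1, hj.2 w hw⟩

/-- The pairs `(i, v)` such that `i` has colour `α` and `v` is not yet a root of `R i`. -/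
def freeSlots [Fintype V] (col : Fin k → L) (R : Fin k → Finset V) (α : L) : Finset (Fin k × V) :=
  {e | col e.1 = α ∧ e.2 ∉ R e.1}

theorem mem_freeSlots [Fintype V] {α : L} {e : Fin k × V} :
    e ∈ freeSlots col R α ↔ col e.1 = α ∧ e.2 ∉ R e.1 := by
  simp [freeSlots]

/-- A point `(v, j)` with `col j = α` is avoided by the blocker of `(j, v)`, so it is covered at
least once less than the colour `α` is used. -/
theorem coverCount_sum_le [Fintype V] {α : L} {F : Fin k × V → Multiset (Rect V (Fin k))}
    {S : Fin k × V → Finset L}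
    (hF : ∀ e ∈ freeSlots col R α, IsBlocker d c col R e.1 e.2 (F e) (S e)) (w : V) (j : Fin k) :
    Rect.coverCount (∑ e ∈ freeSlots col R α, F e) w j ≤
      ((freeSlots col R α).filter fun e => col j ∈ S e).card - if col j = α then 1 else 0 := by
  have hle : Rect.coverCount (∑ e ∈ freeSlots col R α, F e) w j ≤ ((freeSlots col R α).filter
      fun e => col j ∈ S e ∧ w ∉ insertAt R e.1 e.2 j).card := by
    rw [Rect.coverCount_sum, Finset.card_filter]
    exact Finset.sum_le_sum fun e he => (hF e he).coverCount_le w j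
  have hsub : ((freeSlots col R α).filter fun e => col j ∈ S e ∧ w ∉ insertAt R e.1 e.2 j) ⊆
      (freeSlots col R α).filter fun e => col j ∈ S e :=
    Finset.monotone_filter_right _ fun _ _ => And.left
  split_ifs with hj
  · by_cases hw : w ∈ R j
    · rw [Finset.filter_eq_empty_iff.2 fun e _ h => h.2 (le_insertAt j hw)] at hle
      exact hle.trans (Nat.zero_le _)
    · have hmem : (j, w) ∈ freeSlots col R α := mem_freeSlots.2 ⟨hj, hw⟩
      refine hle.trans (Nat.le_sub_one_of_lt (Finset.card_lt_card
        (Finset.ssubset_iff_of_subset hsub |>.2 ⟨(j, w), ?_, fun h => ?_⟩)))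
      · exact Finset.mem_filter.2 ⟨hmem, (hF _ hmem).col_mem⟩
      · exact (Finset.mem_filter.1 h).2.2 mem_insertAt_self
  · exact hle.trans (Finset.card_le_card hsub)

theorem sum_card_filter_sub_mul {ε : Type*} [Fintype L] {T : Finset ε} {S : ε → Finset L} {α : L}
    (hT : T.Nonempty) (hα : ∀ e ∈ T, α ∈ S e) (b : L → ℤ) :
    ∑ β, (((T.filter fun e => β ∈ S e).card - if β = α then 1 else 0 : ℕ) : ℤ) * b β =
      ∑ e ∈ T, ∑ β ∈ S e, b β - b α := by
  have hcast : ∀ β, (((T.filter fun e => β ∈ S e).card - if β = α then 1 else 0 : ℕ) : ℤ) * b β =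
      ∑ _e ∈ T.filter (β ∈ S ·), b β - if β = α then b β else 0 := by
    intro β
    rw [Finset.sum_const, nsmul_eq_mul]
    split_ifs with h
    · rw [h, Finset.filter_true_of_mem hα, Nat.cast_sub hT.card_pos]
      ring
    · simp
  simp only [hcast, Finset.sum_sub_distrib, Finset.sum_ite_eq', Finset.mem_univ, if_true]
  congr 1
  exact Finset.sum_comm' fun β _ => by simp [and_comm]

theorem PackingCondition.exists_insertAt [Fintype V] [Finite L]
    (hd : ∀ X Y, (X ∩ Y).Nonempty → d (X ∩ Y) + d (X ∪ Y) ≤ d X + d Y)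
    (hR : PackingCondition d c col R) {α : L} (hα : 0 < slack c col R α)
    (hfree : (freeSlots col R α).Nonempty) :
    ∃ e ∈ freeSlots col R α, PackingCondition d c col (insertAt R e.1 e.2) := by
  cases nonempty_fintype L
  by_contra! hno
  have hblock : ∀ e ∈ freeSlots col R α, ∃ F S, IsBlocker d c col R e.1 e.2 F S := fun e he =>
    hR.exists_isBlocker (mem_freeSlots.1 he).2 (hno e he)
  choose! F S hF using hblock
  have hαS : ∀ e ∈ freeSlots col R α, α ∈ S e := fun e he =>
    (mem_freeSlots.1 he).1 ▸ (hF e he).col_mem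
  have hne : ∀ G ∈ ∑ e ∈ freeSlots col R α, F e, G.1.Nonempty := by
    intro G hG
    obtain ⟨e, he, hG⟩ := Multiset.mem_sum.1 hG
    exact (hF e he).nonempty G hG
  have hle := calc ∑ e ∈ freeSlots col R α, ∑ β ∈ S e, slack c col R β
      ≤ ∑ e ∈ freeSlots col R α, ((F e).map (demand d R)).sum :=
        Finset.sum_le_sum fun e he => (hF e he).sum_slack_le
    _ = ((∑ e ∈ freeSlots col R α, F e).map (demand d R)).sum :=
        (map_sum (Multiset.sumAddMonoidHom.comp (Multiset.mapAddMonoidHom (demand d R))) _ _).symm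
    _ ≤ ∑ β, _ * slack c col R β :=
        hR.boundedOnDisjoint.sum_le_of_coverCount_le (demand_add_le hd R) hne
          (coverCount_sum_le hF)
    _ = _ := sum_card_filter_sub_mul hfree hαS _
  omega

theorem PackingCondition.exists_roots [Finite V] [Finite L]
    (hd : ∀ X Y, (X ∩ Y).Nonempty → d (X ∩ Y) + d (X ∪ Y) ≤ d X + d Y)
    (hU : PackingCondition d c col U) :
    ∃ R, U ≤ R ∧ (∀ α, 0 ≤ slack c col R α) ∧
      ∀ X : Finset V, X.Nonempty → (missedBy R Finset.univ X).card ≤ d X := by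
  cases nonempty_fintype V
  cases nonempty_fintype L
  obtain ⟨R, hUR, hmax⟩ := Set.Finite.exists_le_maximal
    (Set.toFinite {R | PackingCondition d c col R}) hU
  have hR : PackingCondition d c col R := hmax.prop
  have hfull : ∀ α, 0 < slack c col R α → freeSlots col R α = ∅ := by
    intro α hα
    by_contra hfree
    obtain ⟨e, he, hQ⟩ := hR.exists_insertAt hd hα (Finset.nonempty_of_ne_empty hfree)
    exact hmax.not_gt hQ (lt_insertAt (mem_freeSlots.1 he).2)
  refine ⟨R, hUR, hR.slack_nonneg, fun X hX => ?_⟩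
  let S : Finset L := {α | slack c col R α = 0}
  have hle := hR {X} (by simpa using hX) (by simp) S
  rw [Finset.sum_singleton, Finset.sum_eq_zero fun α hα => (Finset.mem_filter.1 hα).2] at hle
  have hsub : missedBy R Finset.univ X ⊆ missedBy R (coloredIn col S) X := by
    intro i hi
    refine mem_missedBy.2 ⟨mem_coloredIn.2 (by_contra fun hiS => ?_), (mem_missedBy.1 hi).2⟩
    obtain ⟨v, hv⟩ := hX
    have hpos : 0 < slack c col R (col i) :=
      (hR.slack_nonneg _).lt_of_ne' fun h => hiS (by simpa [S] using h)
    have hmem : (i, v) ∈ freeSlots col R (col i) :=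
      mem_freeSlots.2 ⟨rfl, (mem_missedBy.1 hi).2 v hv⟩
    simp [hfull _ hpos] at hmem
  have hcard := Finset.card_le_card hsub
  simp only [demand, OrderDual.ofDual_toDual] at hle
  omega

theorem demand_le_sum_card_inter_sdiff (h : (missedBy R Finset.univ X).card ≤ d X)
    (J : Finset (Fin k)) :
    demand d U (X, toDual J) ≤ ∑ i ∈ J, ((X ∩ (R i \ U i)).card : ℤ) := by
  have hsub : missedBy U J X ⊆
      missedBy R Finset.univ X ∪ J.filter fun i => (X ∩ (R i \ U i)).Nonempty := by
    intro i hi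
    rw [mem_missedBy] at hi
    by_cases hR : ∀ v ∈ X, v ∉ R i
    · exact Finset.mem_union_left _ (mem_missedBy.2 ⟨Finset.mem_univ i, hR⟩)
    · push Not at hR
      obtain ⟨v, hv, hvR⟩ := hR
      exact Finset.mem_union_right _ (Finset.mem_filter.2 ⟨hi.1, v, by simp [hv, hvR, hi.2 v hv]⟩)
  have hfilter : (J.filter fun i => (X ∩ (R i \ U i)).Nonempty).card ≤
      ∑ i ∈ J, (X ∩ (R i \ U i)).card := by
    rw [Finset.card_eq_sum_ones, Finset.sum_filter]
    refine Finset.sum_le_sum fun i _ => ?_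
    split_ifs with hi
    exacts [hi.card_pos, Nat.zero_le _]
  have hcard := (Finset.card_le_card hsub).trans (Finset.card_union_le _ _)
  have := (Nat.cast_le (α := ℤ)).2 hfilter
  push_cast at this
  simp only [demand, OrderDual.ofDual_toDual]
  omega

theorem sum_card_inter_le {M : Finset (Finset V)} (hM : (M : Set (Finset V)).PairwiseDisjoint id)
    (Y : Finset V) : ∑ X ∈ M, (X ∩ Y).card ≤ Y.card := by
  have hdis : (M : Set (Finset V)).PairwiseDisjoint (· ∩ Y) :=
    hM.mono fun _ => Finset.inter_subset_left
  rw [← Finset.card_biUnion hdis]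
  exact Finset.card_le_card (Finset.biUnion_subset.2 fun X _ => Finset.inter_subset_right)

theorem PackingCondition.of_roots (hUR : U ≤ R) (hslack : ∀ α, 0 ≤ slack c col R α)
    (hR : ∀ X : Finset V, X.Nonempty → (missedBy R Finset.univ X).card ≤ d X) :
    PackingCondition d c col U := by
  intro M hne hdis S
  have hsum (i : Fin k) : ∑ X ∈ M, ((X ∩ (R i \ U i)).card : ℤ) ≤ (R i).card - (U i).card := by
    rw [← Nat.cast_sub (Finset.card_le_card (hUR i)), ← Finset.card_sdiff_of_subset (hUR i)]
    exact_mod_cast sum_card_inter_le hdis _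
  calc ∑ X ∈ M, demand d U (X, toDual (coloredIn col S))
      ≤ ∑ X ∈ M, ∑ i ∈ coloredIn col S, ((X ∩ (R i \ U i)).card : ℤ) :=
        Finset.sum_le_sum fun X hX => demand_le_sum_card_inter_sdiff (hR X (hne X hX)) _
    _ ≤ ∑ i ∈ coloredIn col S, (((R i).card : ℤ) - (U i).card) := by
        rw [Finset.sum_comm]
        exact Finset.sum_le_sum fun i _ => hsum i
    _ = ∑ α ∈ S, slack c col U α - ∑ α ∈ S, slack c col R α := by
        rw [Finset.sum_sub_distrib]
        linarith [sum_slack_add_sum_card c col R S,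
          sum_slack_add_sum_card c col U S]
    _ ≤ ∑ α ∈ S, slack c col U α := sub_le_self _ (Finset.sum_nonneg fun α _ => hslack α)

theorem exists_roots_iff_packingCondition [Finite V] [Finite L]
    (hd : ∀ X Y, (X ∩ Y).Nonempty → d (X ∩ Y) + d (X ∪ Y) ≤ d X + d Y) :
    (∃ R, U ≤ R ∧ (∀ α, 0 ≤ slack c col R α) ∧
      ∀ X : Finset V, X.Nonempty → (missedBy R Finset.univ X).card ≤ d X) ↔
      PackingCondition d c col U :=
  ⟨fun ⟨_, hUR, hslack, hR⟩ => .of_roots hUR hslack hR, fun hU => hU.exists_roots hd⟩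

end RootSets

namespace MultiDigraph

section Edmonds

variable {V A : Type*} [DecidableEq V] (D : MultiDigraph V A) {k : ℕ}

/-- The arcs of `E` with tail outside `X` and head in `X`. -/
def entering (E : Finset A) (X : Finset V) : Finset A :=
  E.filter fun a => D.tail a ∉ X ∧ D.head a ∈ X

/-- The cut condition for packing, in the arc set `E`, spanning branchings whose `i`-th member
starts from the vertex set `W i`. -/
def EdmondsCondition (E : Finset A) (W : Fin k → Finset V) : Prop :=
  ∀ X : Finset V, X.Nonempty → (missedBy W Finset.univ X).card ≤ (D.entering E X).card

/-- A set for which the cut condition holds with equality. -/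
def IsTight (E : Finset A) (W : Fin k → Finset V) (X : Finset V) : Prop :=
  (missedBy W Finset.univ X).card = (D.entering E X).card

variable {D} {E : Finset A} {W : Fin k → Finset V} {X Y : Finset V} {i : Fin k}

theorem card_entering_inter_add_union_le (E : Finset A) (X Y : Finset V) :
    (D.entering E (X ∩ Y)).card + (D.entering E (X ∪ Y)).card ≤
      (D.entering E X).card + (D.entering E Y).card := by
  simp only [entering, Finset.card_filter, ← Finset.sum_add_distrib]
  refine Finset.sum_le_sum fun a _ => ?_
  simp only [Finset.mem_inter, Finset.mem_union]
  split_ifs <;> first | omega | (exfalso; tauto)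

theorem EdmondsCondition.missedBy_inter (h : D.EdmondsCondition E W) (hX : D.IsTight E W X)
    (hY : D.IsTight E W Y) (hXY : (X ∩ Y).Nonempty) :
    D.IsTight E W (X ∩ Y) ∧
      missedBy W Finset.univ (X ∩ Y) = missedBy W Finset.univ X ∪ missedBy W Finset.univ Y := by
  have hunion := missedBy_union_subset W Finset.univ Finset.univ X Y
  have hinter := missedBy_inter_subset W Finset.univ Finset.univ X Y
  rw [Finset.union_self] at hunion
  rw [Finset.inter_self] at hinter
  have hcard := Finset.card_union_add_card_inter (missedBy W Finset.univ X)
    (missedBy W Finset.univ Y)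
  have hsub := D.card_entering_inter_add_union_le E X Y
  have hle := h (X ∩ Y) hXY
  have hle' := h (X ∪ Y) (hXY.mono (Finset.inter_subset_left.trans Finset.subset_union_left))
  have := Finset.card_le_card hunion
  have := Finset.card_le_card hinter
  rw [IsTight] at hX hY ⊢
  exact ⟨by omega, (Finset.eq_of_subset_of_card_le hunion (by omega)).symm⟩

theorem EdmondsCondition.exists_arc_of_isTight (h : D.EdmondsCondition E W)
    (hX : D.IsTight E W X) (hi : i ∉ missedBy W Finset.univ X) (hne : (X \ W i).Nonempty) :
    ∃ a ∈ E, D.tail a ∈ X ∧ D.tail a ∈ W i ∧ D.head a ∈ X ∧ D.head a ∉ W i := by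
  have hmissed : insert i (missedBy W Finset.univ X) ⊆ missedBy W Finset.univ (X \ W i) := by
    intro j hj
    simp only [Finset.mem_insert, mem_missedBy, Finset.mem_univ, true_and, Finset.mem_sdiff] at hj ⊢
    rintro v ⟨hv, hvi⟩
    rcases hj with rfl | hj
    exacts [hvi, hj v hv]
  have hlt : (D.entering E X).card < (D.entering E (X \ W i)).card := by
    have := Finset.card_le_card hmissed
    rw [Finset.card_insert_of_notMem hi, hX] at this
    exact this.trans (h _ hne)
  obtain ⟨a, ha, haX⟩ := Finset.exists_mem_notMem_of_card_lt_card hlt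
  simp only [entering, Finset.mem_filter, Finset.mem_sdiff] at ha haX
  grind

theorem EdmondsCondition.erase [DecidableEq A] (h : D.EdmondsCondition E W) {a : A}
    (ha : ∀ Y, D.IsTight E W Y → a ∈ D.entering E Y → i ∈ missedBy W Finset.univ Y) :
    D.EdmondsCondition (E.erase a) (insertAt W i (D.head a)) := by
  intro Y hY
  have hsub : missedBy (insertAt W i (D.head a)) Finset.univ Y ⊆ missedBy W Finset.univ Y :=
    missedBy_anti le_insertAt _ _
  have herase : D.entering (E.erase a) Y = (D.entering E Y).erase a := Finset.filter_erase ..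
  rw [herase]
  by_cases haY : a ∈ D.entering E Y
  · rw [Finset.card_erase_of_mem haY]
    refine Nat.le_sub_one_of_lt ?_
    rcases (h Y hY).lt_or_eq with hlt | htight
    · exact (Finset.card_le_card hsub).trans_lt hlt
    · refine htight ▸ Finset.card_lt_card ((Finset.ssubset_iff_of_subset hsub).2
        ⟨i, ha Y htight haY, fun hi => ?_⟩)
      exact (mem_missedBy.1 hi).2 _ (Finset.mem_filter.1 haY).2.2 mem_insertAt_self
  · rw [Finset.erase_eq_of_notMem haY]
    exact (Finset.card_le_card hsub).trans (h Y hY)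

/-- Lovász's augmentation step: take an arc leaving `W i` inside a minimal tight set that meets
`W i` but is not contained in it. -/
theorem EdmondsCondition.exists_insertAt [Finite V] [DecidableEq A] (h : D.EdmondsCondition E W)
    {v : V} (hv : v ∉ W i) :
    ∃ a ∈ E, D.tail a ∈ W i ∧ D.head a ∉ W i ∧
      D.EdmondsCondition (E.erase a) (insertAt W i (D.head a)) := by
  cases nonempty_fintype V
  let dangerous (X : Finset V) : Prop :=
    D.IsTight E W X ∧ i ∉ missedBy W Finset.univ X ∧ (X \ W i).Nonempty
  have huniv : dangerous Finset.univ := by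
    have hentering : D.entering E Finset.univ = ∅ := by simp [entering]
    have hmissed : missedBy W Finset.univ Finset.univ = ∅ := by
      simpa [hentering] using h Finset.univ ⟨v, Finset.mem_univ v⟩
    exact ⟨by simp [IsTight, hentering, hmissed], by simp [hmissed], v, by simpa using hv⟩
  obtain ⟨X, -, hX⟩ := (Set.toFinite {X | dangerous X}).exists_le_minimal huniv
  obtain ⟨htight, hiX, hne⟩ := hX.prop
  obtain ⟨a, haE, htX, htW, hhX, hhW⟩ := h.exists_arc_of_isTight htight hiX hne
  refine ⟨a, haE, htW, hhW, h.erase fun Y hY haY => by_contra fun hiY => ?_⟩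
  obtain ⟨-, htY, hhY⟩ := Finset.mem_filter.1 haY
  have hmem : D.head a ∈ X ∩ Y := Finset.mem_inter.2 ⟨hhX, hhY⟩
  obtain ⟨hinter, hmissed⟩ := h.missedBy_inter htight hY ⟨_, hmem⟩
  have hdangerous : dangerous (X ∩ Y) :=
    ⟨hinter, by simp [hmissed, hiX, hiY], _, Finset.mem_sdiff.2 ⟨hmem, hhW⟩⟩
  exact htY (Finset.mem_inter.1 (hX.le_of_le hdangerous Finset.inter_subset_left htX)).2

/-- `D.Spans W F` says that the arcs of `F` can be ordered so that, starting from the vertex set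
`W`, each of them leads from a vertex reached to a new one, and all vertices are reached. -/
inductive Spans [Fintype V] [DecidableEq A] (D : MultiDigraph V A) : Finset V → Finset A → Prop
  | univ : Spans D Finset.univ ∅
  | step (a : A) (W : Finset V) (F : Finset A) (ht : D.tail a ∈ W) (hh : D.head a ∉ W)
      (hF : Spans D (insert (D.head a) W) F) : Spans D W (insert a F)

theorem EdmondsCondition.exists_spans [Fintype V] [DecidableEq A] (h : D.EdmondsCondition E W) :
    ∃ F : Fin k → Finset A, (∀ i, F i ⊆ E) ∧ Pairwise (Function.onFun Disjoint F) ∧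
      ∀ i, D.Spans (W i) (F i) := by
  induction W using WellFoundedGT.induction generalizing E with
  | _ W ih =>
  by_cases hall : ∀ i, W i = Finset.univ
  · exact ⟨fun _ => ∅, fun _ => Finset.empty_subset _, fun _ _ _ => Finset.disjoint_empty_left _,
      fun i => hall i ▸ Spans.univ⟩
  simp only [Finset.eq_univ_iff_forall] at hall
  push Not at hall
  obtain ⟨i, v, hv⟩ := hall
  obtain ⟨a, haE, ht, hh, hstep⟩ := h.exists_insertAt hv
  obtain ⟨F, hFE, hdis, hF⟩ := ih _ (lt_insertAt hh) hstep
  have haF : ∀ j, a ∉ F j := fun j hj => Finset.notMem_erase a E (hFE j hj)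
  refine ⟨insertAt F i a, fun j b hb => ?_, fun j j' hjj => ?_, fun j => ?_⟩
  · rcases mem_insertAt.1 hb with ⟨-, rfl⟩ | hb
    exacts [haE, Finset.mem_of_mem_erase (hFE j hb)]
  · refine Finset.disjoint_left.2 fun b hb hb' => ?_
    rcases mem_insertAt.1 hb with ⟨hj, hba⟩ | hb <;>
      rcases mem_insertAt.1 hb' with ⟨hj', hba'⟩ | hb'
    exacts [hjj (hj.trans hj'.symm), haF _ (hba ▸ hb'), haF _ (hba' ▸ hb),
      Finset.disjoint_left.1 (hdis hjj) hb hb']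
  · have hFj := hF j
    rcases eq_or_ne j i with rfl | hj
    · rw [insertAt_self] at hFj ⊢
      exact .step a _ _ ht hh hFj
    · rwa [insertAt_of_ne hj] at hFj ⊢

end Edmonds

end MultiDigraph

/-- At a vertex of a cycle where `h` is largest, the two neighbours on the cycle would coincide. -/
theorem isAcyclic_of_unique_le_adj {α β : Type*} [LinearOrder β] {G : SimpleGraph α} (h : α → β)
    (hG : ∀ u v w, G.Adj u v → G.Adj u w → h v ≤ h u → h w ≤ h u → v = w) : G.IsAcyclic := by
  classical
  intro x c hc
  obtain ⟨u, hu, hmax⟩ := c.support.toFinset.exists_max_image h ⟨x, by simp⟩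
  simp only [List.mem_toFinset] at hu hmax
  have hc' := hc.rotate hu
  have hle {v : α} (hv : v ∈ (c.rotate u hu).support) : h v ≤ h u :=
    hmax v ((SimpleGraph.Walk.mem_support_rotate_iff ..).1 hv)
  exact hc'.snd_ne_penultimate <| hG u _ _ (SimpleGraph.Walk.adj_snd hc'.not_nil)
    (SimpleGraph.Walk.adj_penultimate hc'.not_nil).symm
    (hle (SimpleGraph.Walk.getVert_mem_support ..)) (hle (SimpleGraph.Walk.getVert_mem_support ..))

namespace MultiDigraph

variable {V A : Type*} {D : MultiDigraph V A}

namespace Subdigraph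

variable {F : D.Subdigraph} {u v r : V} {p : List A} {W : Set V} {h : V → ℕ}

section IsDirWalk

theorem isDirWalk_concat {a : A} :
    F.IsDirWalk u (p ++ [a]) v ↔ F.IsDirWalk u p (D.tail a) ∧ a ∈ F.arcs ∧ D.head a = v := by
  induction p generalizing u with
  | nil =>
    simp only [List.nil_append, IsDirWalk]
    constructor
    · rintro ⟨ha, rfl, -, rfl⟩
      exact ⟨⟨F.tail_mem a ha, rfl⟩, ha, rfl⟩
    · rintro ⟨⟨-, rfl⟩, ha, rfl⟩
      exact ⟨ha, rfl, F.head_mem a ha, rfl⟩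
  | cons b p ih =>
    simp only [List.cons_append, IsDirWalk, ih]
    tauto

theorem underlying_adj_of_mem_arcs {a : A} (ha : a ∈ F.arcs) :
    F.underlying.Adj ⟨D.tail a, F.tail_mem a ha⟩ ⟨D.head a, F.head_mem a ha⟩ :=
  ⟨a, ha, Or.inl ⟨rfl, rfl⟩⟩

theorem IsDirWalk.reachable (hp : F.IsDirWalk u p v) (hu : u ∈ F.verts) (hv : v ∈ F.verts) :
    F.underlying.Reachable ⟨u, hu⟩ ⟨v, hv⟩ := by
  induction p generalizing u with
  | nil =>
    obtain ⟨-, rfl⟩ := hp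
    rfl
  | cons a p ih =>
    obtain ⟨ha, rfl, hp⟩ := hp
    exact (underlying_adj_of_mem_arcs ha).reachable.trans (ih hp _)

theorem IsDirWalk.pairwise_lt (hlt : ∀ a ∈ F.arcs, h (D.tail a) < h (D.head a))
    (hp : F.IsDirWalk u p v) : (u :: p.map D.head).Pairwise fun x y => h x < h y := by
  rw [← List.isChain_iff_pairwise]
  induction p generalizing u with
  | nil => exact .singleton u
  | cons a p ih =>
    obtain ⟨ha, rfl, hp⟩ := hp
    exact .cons_cons (hlt a ha) (ih hp)

theorem IsDirWalk.exists_entering {X : Set V} (hp : F.IsDirWalk u p v) (hu : u ∉ X)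
    (hv : v ∈ X) : ∃ a ∈ F.arcs, D.tail a ∉ X ∧ D.head a ∈ X := by
  induction p generalizing u with
  | nil => exact absurd (hp.2 ▸ hv) hu
  | cons a p ih =>
    obtain ⟨ha, rfl, hp⟩ := hp
    by_cases hh : D.head a ∈ X
    exacts [⟨a, ha, hu, hh⟩, ih hp hh]

end IsDirWalk

/-- `F` is a forest of arborescences with the set of roots `W`, in terms of arcs alone: each vertex
outside `W` has exactly one entering arc, the vertices of `W` have none, and there is no directed
cycle, as witnessed by a function `h` that increases along arcs. -/
structure IsRootedForest (F : D.Subdigraph) (W : Set V) (h : V → ℕ) : Prop where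
  subset_verts : W ⊆ F.verts
  height_lt : ∀ a ∈ F.arcs, h (D.tail a) < h (D.head a)
  head_notMem : ∀ a ∈ F.arcs, D.head a ∉ W
  existsUnique_arc : ∀ v ∈ F.verts, v ∉ W → ∃! a, a ∈ F.arcs ∧ D.head a = v

namespace IsRootedForest

theorem injOn_head (H : F.IsRootedForest W h) : Set.InjOn D.head F.arcs := fun a ha _ hb hab =>
  (H.existsUnique_arc _ (F.head_mem a ha) (H.head_notMem a ha)).unique ⟨ha, rfl⟩ ⟨hb, hab.symm⟩

theorem isDirWalk_to_root (H : F.IsRootedForest W h) (hr : r ∈ W) (hp : F.IsDirWalk u p r) :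
    u = r ∧ p = [] := by
  rcases p.eq_nil_or_concat' with rfl | ⟨q, a, rfl⟩
  · exact ⟨hp.2, rfl⟩
  · obtain ⟨-, ha, rfl⟩ := isDirWalk_concat.1 hp
    exact absurd hr (H.head_notMem a ha)

theorem existsUnique_isDirWalk (H : F.IsRootedForest W h) (hv : v ∈ F.verts) :
    ∃! q : V × List A, q.1 ∈ W ∧ F.IsDirWalk q.1 q.2 v := by
  induction hn : h v using Nat.strong_induction_on generalizing v with
  | _ n ih =>
  by_cases hvW : v ∈ W
  · refine ⟨(v, []), ⟨hvW, hv, rfl⟩, fun q hq => ?_⟩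
    obtain ⟨hqv, hq⟩ := H.isDirWalk_to_root hvW hq.2
    exact Prod.ext hqv hq
  · obtain ⟨a, ⟨ha, rfl⟩, -⟩ := H.existsUnique_arc v hv hvW
    obtain ⟨⟨r, p⟩, ⟨hr, hp⟩, hunique⟩ := ih _ (hn ▸ H.height_lt a ha) (F.tail_mem a ha) rfl
    refine ⟨(r, p ++ [a]), ⟨hr, isDirWalk_concat.2 ⟨hp, ha, rfl⟩⟩, ?_⟩
    rintro ⟨s, q⟩ ⟨hs, hwalk⟩
    rcases q.eq_nil_or_concat' with rfl | ⟨q, b, rfl⟩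
    · exact absurd (hwalk.2 ▸ hs) hvW
    · obtain ⟨hq, hb, hba⟩ := isDirWalk_concat.1 hwalk
      obtain rfl := H.injOn_head hb ha hba
      obtain ⟨rfl, rfl⟩ := Prod.ext_iff.1 (hunique (s, q) ⟨hs, hq⟩)
      rfl

theorem exists_isDirWalk_tail_iff (H : F.IsRootedForest W h) (hr : r ∈ W) {a : A}
    (ha : a ∈ F.arcs) :
    (∃ p, F.IsDirWalk r p (D.tail a)) ↔ ∃ p, F.IsDirWalk r p (D.head a) := by
  refine ⟨fun ⟨p, hp⟩ => ⟨p ++ [a], isDirWalk_concat.2 ⟨hp, ha, rfl⟩⟩, fun ⟨p, hp⟩ => ?_⟩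
  obtain ⟨⟨s, q⟩, ⟨hs, hq⟩, -⟩ := H.existsUnique_isDirWalk (F.tail_mem a ha)
  have hq' : F.IsDirWalk s (q ++ [a]) (D.head a) := isDirWalk_concat.2 ⟨hq, ha, rfl⟩
  obtain rfl : s = r := congrArg Prod.fst <| (H.existsUnique_isDirWalk (F.head_mem a ha)).unique
    (y₁ := (s, q ++ [a])) (y₂ := (r, p)) ⟨hs, hq'⟩ ⟨hr, hp⟩
  exact ⟨q, hq⟩

theorem exists_isDirWalk_of_reachable (H : F.IsRootedForest W h) {x y : F.verts} (hx : x.1 ∈ W)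
    (hxy : F.underlying.Reachable x y) : ∃ p, F.IsDirWalk x p y := by
  rw [SimpleGraph.reachable_iff_reflTransGen] at hxy
  induction hxy with
  | refl => exact ⟨[], x.2, rfl⟩
  | tail _ hadj ih =>
    obtain ⟨a, ha, ⟨ht, hh⟩ | ⟨ht, hh⟩⟩ := hadj
    · exact hh ▸ (H.exists_isDirWalk_tail_iff hx ha).1 (ht ▸ ih)
    · exact ht ▸ (H.exists_isDirWalk_tail_iff hx ha).2 (hh ▸ ih)

theorem underlying_isAcyclic (H : F.IsRootedForest W h) : F.underlying.IsAcyclic := by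
  have hhead {u v : F.verts} (huv : F.underlying.Adj u v) (hle : h v ≤ h u) :
      ∃ a ∈ F.arcs, D.tail a = v ∧ D.head a = u := by
    obtain ⟨a, ha, ⟨ht, hh⟩ | hvu⟩ := huv
    · exact absurd hle (not_le.2 (ht ▸ hh ▸ H.height_lt a ha))
    · exact ⟨a, ha, hvu⟩
  refine isAcyclic_of_unique_le_adj (fun v : F.verts => h v) fun u v w huv huw hv hw => ?_
  obtain ⟨a, ha, hav, hau⟩ := hhead huv hv
  obtain ⟨b, hb, hbw, hbu⟩ := hhead huw hw
  obtain rfl := H.injOn_head ha hb (hau.trans hbu.symm)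
  exact Subtype.ext (hav.symm.trans hbw)

theorem isUnderlyingTree (H : F.IsRootedForest {r} h) : F.IsUnderlyingTree := by
  have hr : r ∈ F.verts := H.subset_verts rfl
  refine ⟨⟨(SimpleGraph.connected_iff_exists_forall_reachable _).2 ⟨⟨r, hr⟩, fun v => ?_⟩,
    H.underlying_isAcyclic⟩, fun a ha b hb hab => ?_⟩
  · obtain ⟨⟨_, p⟩, ⟨rfl, hp⟩, -⟩ := H.existsUnique_isDirWalk v.2
    exact hp.reachable hr v.2
  · rcases Sym2.eq_iff.1 hab with ⟨-, hh⟩ | ⟨hth, hht⟩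
    · exact H.injOn_head ha hb hh
    · have hab := H.height_lt a ha
      rw [hth, hht] at hab
      exact absurd hab (H.height_lt b hb).asymm

theorem isArborescence (H : F.IsRootedForest {r} h) : F.IsArborescence r := by
  refine ⟨H.subset_verts rfl, H.isUnderlyingTree, fun u hu => ?_⟩
  obtain ⟨⟨_, p⟩, ⟨rfl, hp⟩, hunique⟩ := H.existsUnique_isDirWalk hu
  refine ⟨p, ⟨hp, (hp.pairwise_lt H.height_lt).imp fun hlt e => hlt.ne (congrArg h e)⟩,
    fun q hq => congrArg Prod.snd (hunique (_, q) ⟨rfl, hq.1⟩)⟩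

theorem exists_root_of_component (H : F.IsRootedForest W h) (C : F.underlying.ConnectedComponent) :
    ∃ r : F.verts, r.1 ∈ W ∧ F.underlying.connectedComponentMk r = C := by
  induction C using SimpleGraph.ConnectedComponent.ind with
  | _ v =>
  obtain ⟨⟨r, p⟩, ⟨hr, hp⟩, -⟩ := H.existsUnique_isDirWalk v.2
  exact ⟨⟨r, H.subset_verts hr⟩, hr,
    SimpleGraph.ConnectedComponent.eq.2 (hp.reachable (H.subset_verts hr) v.2)⟩

theorem component (H : F.IsRootedForest W h) {r : F.verts} (hr : r.1 ∈ W) :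
    (F.component (F.underlying.connectedComponentMk r)).IsRootedForest {r.1} h where
  subset_verts := by
    rintro _ rfl
    exact ⟨r.2, r, rfl, rfl⟩
  height_lt a ha := H.height_lt a ha.1
  head_notMem a ha hra := H.head_notMem a ha.1 (hra ▸ hr)
  existsUnique_arc := by
    rintro _ ⟨-, v, hv, rfl⟩ hvr
    have hvW : v.1 ∉ W := fun hvW => by
      obtain ⟨p, hp⟩ :=
        H.exists_isDirWalk_of_reachable hr (SimpleGraph.ConnectedComponent.eq.1 hv).symm
      exact hvr (H.isDirWalk_to_root hvW hp).1.symm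
    obtain ⟨a, ⟨ha, hav⟩, hunique⟩ := H.existsUnique_arc v v.2 hvW
    refine ⟨a, ⟨⟨ha, ⟨⟨D.tail a, F.tail_mem a ha⟩, ?_, rfl⟩, hav ▸ ⟨v, hv, rfl⟩⟩, hav⟩,
      fun b hb => hunique b ⟨hb.1.1, hb.2⟩⟩
    have hadj : F.underlying.Adj ⟨D.tail a, F.tail_mem a ha⟩ v := ⟨a, ha, Or.inl ⟨rfl, hav⟩⟩
    exact (SimpleGraph.ConnectedComponent.connectedComponentMk_eq_of_adj hadj).trans hv

theorem isBranching (H : F.IsRootedForest W h) (hF : F.verts = Set.univ) : F.IsBranching := by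
  refine ⟨hF, fun C => ?_⟩
  obtain ⟨r, hr, rfl⟩ := H.exists_root_of_component C
  exact ⟨r, (H.component hr).isArborescence⟩

theorem rootSet_eq (H : F.IsRootedForest W h) : F.rootSet = W := by
  ext s
  constructor
  · rintro ⟨C, hC⟩
    obtain ⟨r, hr, rfl⟩ := H.exists_root_of_component C
    have hcomp := H.component hr
    obtain ⟨p, hp, -⟩ := hC.2.2 r (hcomp.subset_verts rfl)
    exact (hcomp.isDirWalk_to_root rfl hp.1).1 ▸ hr
  · exact fun hs => ⟨_, (H.component (r := ⟨s, H.subset_verts hs⟩) hs).isArborescence⟩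

end IsRootedForest

theorem IsBranching.exists_entering (hF : F.IsBranching) {X : Set V} (hX : X.Nonempty)
    (hroot : ∀ r ∈ F.rootSet, r ∉ X) : ∃ a ∈ F.arcs, D.tail a ∉ X ∧ D.head a ∈ X := by
  obtain ⟨x, hx⟩ := hX
  have hxF : x ∈ F.verts := hF.1 ▸ Set.mem_univ x
  obtain ⟨r, hr⟩ := hF.2 (F.underlying.connectedComponentMk ⟨x, hxF⟩)
  obtain ⟨p, hp, -⟩ := hr.2.2 x ⟨hxF, ⟨x, hxF⟩, rfl, rfl⟩
  obtain ⟨a, ha, haX⟩ := hp.1.exists_entering (hroot r ⟨_, hr⟩) hx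
  exact ⟨a, ha.1, haX⟩

end Subdigraph

/-- The spanning subdigraph with a given arc set. -/
def spanning (D : MultiDigraph V A) (F : Set A) : D.Subdigraph where
  verts := Set.univ
  arcs := F
  tail_mem _ _ := Set.mem_univ _
  head_mem _ _ := Set.mem_univ _

theorem Spans.exists_isRootedForest [Fintype V] [DecidableEq V] [DecidableEq A] {W : Finset V}
    {F : Finset A} (hF : D.Spans W F) : ∃ h, (D.spanning F).IsRootedForest W h := by
  induction hF with
  | univ => exact ⟨fun _ => 0, by constructor <;> simp [spanning]⟩
  | step a W F ht hh _ ih =>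
    obtain ⟨h, H⟩ := ih
    have hF {b} (hb : b ∈ F) : D.head b ≠ D.head a ∧ D.head b ∉ W := by
      simpa using H.head_notMem b hb
    refine ⟨fun x => if x ∈ W then 0 else h x + 1, Set.subset_univ _, fun b hb => ?_,
      fun b hb => ?_, fun v _ hv => ?_⟩
    · rcases Finset.mem_insert.1 hb with rfl | hb
      · simp [ht, hh]
      · have := H.height_lt b hb
        simp only [if_neg (hF hb).2]
        split_ifs <;> omega
    · rcases Finset.mem_insert.1 hb with rfl | hb
      exacts [hh, (hF hb).2]
    · by_cases hva : v = D.head a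
      · subst hva
        exact ⟨a, ⟨Finset.mem_insert_self _ _, rfl⟩, fun b hb =>
          (Finset.mem_insert.1 hb.1).resolve_right fun hbF => (hF hbF).1 hb.2⟩
      · obtain ⟨b, ⟨hb, hbv⟩, hunique⟩ := H.existsUnique_arc v (Set.mem_univ v)
          (by simpa [hva] using hv)
        refine ⟨b, ⟨Finset.mem_insert_of_mem hb, hbv⟩, fun b' hb' => hunique b' ⟨?_, hb'.2⟩⟩
        exact (Finset.mem_insert.1 hb'.1).resolve_left fun e => hva (e ▸ hb'.2.symm)

theorem edmondsCondition_of_isBranching [Fintype A] [DecidableEq V] {k : ℕ}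
    {B : Fin k → D.Subdigraph} {R : Fin k → Finset V} (hB : ∀ i, (B i).IsBranching)
    (hdis : ∀ i j, i ≠ j → Disjoint (B i).arcs (B j).arcs) (hR : ∀ i, (B i).rootSet = R i) :
    D.EdmondsCondition Finset.univ R := by
  intro X hX
  have hentering : ∀ i ∈ missedBy R Finset.univ X,
      ∃ a ∈ (B i).arcs, D.tail a ∉ X ∧ D.head a ∈ X := fun i hi =>
    (hB i).exists_entering (X := X) hX fun r hr hrX =>
      (mem_missedBy.1 hi).2 r hrX (by simpa [hR i] using hr)
  choose f hf hfX using hentering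
  rw [← Finset.card_attach]
  refine Finset.card_le_card_of_injOn (fun i => f i.1 i.2)
    (fun i _ => by simpa [entering] using hfX i.1 i.2) fun i _ j _ hij => by_contra fun hne => ?_
  have hij' : f i.1 i.2 = f j.1 j.2 := hij
  exact Set.disjoint_left.1 (hdis i.1 j.1 fun e => hne (Subtype.ext e)) (hf i.1 i.2)
    (hij' ▸ hf j.1 j.2)

/-- Edmonds' disjoint branchings theorem. -/
theorem exists_disjoint_branchings_iff [Finite V] [Fintype A] [DecidableEq V] {k : ℕ}
    {R : Fin k → Finset V} :
    (∃ B : Fin k → D.Subdigraph, (∀ i, (B i).IsBranching) ∧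
      (∀ i j, i ≠ j → Disjoint (B i).arcs (B j).arcs) ∧ ∀ i, (B i).rootSet = R i) ↔
      D.EdmondsCondition Finset.univ R := by
  classical
  cases nonempty_fintype V
  refine ⟨fun ⟨B, hB, hdis, hR⟩ => edmondsCondition_of_isBranching hB hdis hR, fun h => ?_⟩
  obtain ⟨F, -, hdis, hF⟩ := h.exists_spans
  choose ht H using fun i => (hF i).exists_isRootedForest
  exact ⟨fun i => D.spanning (F i), fun i => (H i).isBranching rfl,
    fun i j hij => Finset.disjoint_coe.2 (hdis hij), fun i => (H i).rootSet_eq⟩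

end MultiDigraph

section BlockPartition

open OrderDual (toDual)

variable {V : Type*} {k l : ℕ} {I : Fin l → Finset (Fin k)}

theorem forall_disjoint_family_sum_le_iff {f : Finset V → ℤ} {b : ℤ} :
    (∀ M : Finset (Finset V), (∀ X ∈ M, X.Nonempty) → (M : Set (Finset V)).PairwiseDisjoint id →
      ∑ X ∈ M, f X ≤ b) ↔
      ∀ (t : ℕ) (X : Fin t → Finset V), (∀ j, (X j).Nonempty) →
        (∀ j j', j ≠ j' → Disjoint (X j) (X j')) → ∑ j, f (X j) ≤ b := by
  classical
  refine ⟨fun h t X hne hdis => ?_, fun h M hne hdis => ?_⟩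
  · have hinj : Function.Injective X := fun j j' hj => by_contra fun hjj =>
      (hne j).ne_empty (disjoint_self.1 (hj ▸ hdis j j' hjj))
    have := h (Finset.univ.image X) (by simpa using hne) (by
      rw [Finset.coe_image, hinj.injOn.pairwiseDisjoint_image]
      exact fun j _ j' _ hj => hdis j j' hj)
    rwa [Finset.sum_image hinj.injOn] at this
  · have := h M.card (fun j => M.equivFin.symm j) (fun j => hne _ (M.equivFin.symm j).2)
      fun j j' hj => hdis (M.equivFin.symm j).2 (M.equivFin.symm j').2
        fun e => hj (M.equivFin.symm.injective (Subtype.ext e))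
    rwa [Equiv.sum_comp M.equivFin.symm (fun X : M => f X), Finset.sum_coe_sort M f] at this

theorem IsBlockPartition.exists_mem_iff (hI : IsBlockPartition I) :
    ∃ col : Fin k → Fin l, ∀ α i, i ∈ I α ↔ col i = α := by
  have hcover (i : Fin k) : ∃ α, i ∈ I α := by
    simpa using hI.2.2.ge (Finset.mem_univ i)
  choose col hcol using hcover
  refine ⟨col, fun α i => ⟨fun hi => by_contra fun hne => ?_, fun h => h ▸ hcol i⟩⟩
  exact Finset.disjoint_left.1 (hI.2.1 _ _ hne) (hcol i) hi

theorem IsBlockPartition.subset_biUnion_iff (hI : IsBlockPartition I) {S : Finset (Fin l)}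
    {α : Fin l} : I α ⊆ S.biUnion I ↔ α ∈ S := by
  refine ⟨fun h => ?_, Finset.subset_biUnion_of_mem I⟩
  obtain ⟨i, hi⟩ := hI.1 α
  obtain ⟨β, hβ, hiβ⟩ := Finset.mem_biUnion.1 (h hi)
  exact by_contra fun hα => Finset.disjoint_left.1 (hI.2.1 α β fun e => hα (e ▸ hβ)) hi hiβ

variable {col : Fin k → Fin l} {c : Fin l → ℤ} {U : Fin k → Finset V}

theorem slack_eq_sub_sum_block (hcol : ∀ α i, i ∈ I α ↔ col i = α) (α : Fin l) :
    slack c col U α = c α - ∑ i ∈ I α, ((U i).card : ℤ) := by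
  have hblock : I α = Finset.univ.filter fun i => col i = α := by
    ext i
    simp [hcol]
  rw [slack, hblock]

theorem IsBlockPartition.packingCondition_iff [DecidableEq V] (hI : IsBlockPartition I)
    (hcol : ∀ α i, i ∈ I α ↔ col i = α) {d : Finset V → ℤ} :
    PackingCondition d c col U ↔
      ∀ (t : ℕ) (X : Fin t → Finset V), (∀ j, (X j).Nonempty) →
        (∀ j j', j ≠ j' → Disjoint (X j) (X j')) →
        ∀ (S : Finset (Fin l)) (J : Finset (Fin k)), J = S.biUnion I →
          ∑ j, (((missedBy U J (X j)).card : ℤ) - d (X j)) ≤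
            ∑ α with I α ⊆ J, (c α - ∑ i ∈ I α, ((U i).card : ℤ)) := by
  have hunion (S : Finset (Fin l)) : S.biUnion I = coloredIn col S := by
    ext i
    simp [hcol, mem_coloredIn]
  have hsum (S : Finset (Fin l)) : ∑ α with I α ⊆ S.biUnion I,
      (c α - ∑ i ∈ I α, ((U i).card : ℤ)) = ∑ α ∈ S, slack c col U α := by
    simp only [hI.subset_biUnion_iff, Finset.filter_univ_mem, slack_eq_sub_sum_block hcol]
  have hfamily (S : Finset (Fin l)) := forall_disjoint_family_sum_le_iff
    (f := fun X : Finset V => demand d U (X, toDual (coloredIn col S)))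
    (b := ∑ α ∈ S, slack c col U α)
  constructor
  · rintro h t X hne hdis S _ rfl
    rw [hsum, hunion]
    exact (hfamily S).1 (fun M hM hMd => h M hM hMd S) t X hne hdis
  · intro h M hM hMd S
    refine (hfamily S).2 (fun t X hne hdis => ?_) M hM hMd
    have := h t X hne hdis S _ rfl
    rwa [hsum, hunion] at this

theorem MultiDigraph.exists_branchings_iff_exists_roots {A : Type*} [Finite V] [Fintype A]
    [DecidableEq V] (D : MultiDigraph V A) {c' : Fin l → ℕ} (hcol : ∀ α i, i ∈ I α ↔ col i = α) :
    (∃ B : Fin k → D.Subdigraph, (∀ i, (B i).IsBranching) ∧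
        (∀ i j, i ≠ j → Disjoint (B i).arcs (B j).arcs) ∧
        (∀ i, (U i : Set V) ⊆ (B i).rootSet) ∧
        ∀ α, ∑ i ∈ I α, (B i).rootSet.ncard ≤ c' α) ↔
      ∃ R, U ≤ R ∧ (∀ α, 0 ≤ slack (c' ·) col R α) ∧ D.EdmondsCondition Finset.univ R := by
  have hbound {B : Fin k → D.Subdigraph} {R : Fin k → Finset V}
      (hR : ∀ i, (B i).rootSet = R i) (α : Fin l) :
      ∑ i ∈ I α, (B i).rootSet.ncard ≤ c' α ↔ 0 ≤ slack (c' ·) col R α := by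
    rw [slack_eq_sub_sum_block hcol, sub_nonneg]
    simp only [hR, Set.ncard_coe_finset]
    norm_cast
  constructor
  · rintro ⟨B, hB, hdis, hUB, hc⟩
    choose R hR using fun i => (B i).rootSet.toFinite.exists_finset_coe
    replace hR := fun i => (hR i).symm
    exact ⟨R, fun i => Finset.coe_subset.1 (hR i ▸ hUB i), fun α => (hbound hR α).1 (hc α),
      exists_disjoint_branchings_iff.1 ⟨B, hB, hdis, hR⟩⟩
  · rintro ⟨R, hUR, hslack, hcut⟩
    obtain ⟨B, hB, hdis, hR⟩ := exists_disjoint_branchings_iff.2 hcut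
    exact ⟨B, hB, hdis, fun i => hR i ▸ Finset.coe_subset.2 (hUR i),
      fun α => (hbound hR α).2 (hslack α)⟩

end BlockPartition

theorem corollary4p10 {V A : Type*} [Fintype V] [DecidableEq V] [Fintype A]
    (D : MultiDigraph V A) {k l : ℕ} (hk : 0 < k)
    (I : Fin l → Finset (Fin k)) (hI : IsBlockPartition I)
    (c' : Fin l → ℕ) (U : Fin k → Finset V)
    (hU : ∀ α, ∑ i ∈ I α, (U i).card ≤ c' α) :
    (∃ B : Fin k → D.Subdigraph,
        (∀ i, (B i).IsBranching) ∧
        (∀ i j, i ≠ j → Disjoint (B i).arcs (B j).arcs) ∧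
        (∀ i, (U i : Set V) ⊆ (B i).rootSet) ∧
        ∀ α, ∑ i ∈ I α, (B i).rootSet.ncard ≤ c' α) ↔
      ∀ (t : ℕ) (X : Fin t → Finset V),
        (∀ j, (X j).Nonempty) →
        (∀ j j', j ≠ j' → Disjoint (X j) (X j')) →
        ∀ S : Finset (Fin l), ∀ J : Finset (Fin k), J = S.biUnion I →
          ∑ j, (((missedBy U J (X j)).card : ℤ) - (D.inDegree (X j) : ℤ)) ≤
            ∑ α with I α ⊆ J, ((c' α : ℤ) - ∑ i ∈ I α, ((U i).card : ℤ)) := by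
  obtain ⟨col, hcol⟩ := hI.exists_mem_iff
  have hsubmodular (X Y : Finset V) (_ : (X ∩ Y).Nonempty) :
      (D.inDegree (X ∩ Y) : ℤ) + D.inDegree (X ∪ Y) ≤ D.inDegree X + D.inDegree Y :=
    mod_cast D.card_entering_inter_add_union_le Finset.univ X Y
  rw [D.exists_branchings_iff_exists_roots hcol]
  refine Iff.trans ?_ (hI.packingCondition_iff (c := (c' ·)) (d := (D.inDegree ·)) hcol)
  rw [← exists_roots_iff_packingCondition hsubmodular]
  simp only [MultiDigraph.EdmondsCondition, Nat.cast_le]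
  rfl
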